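/- Let $\mathsf{Pos}$ be the category of posets and monotone maps, and let $\mathsf{Pos}_{\mathsf f}$ be a set of finite posets, called contexts (for instance, a set representing all finite posets up to isomorphism). A signature in context $\Sigma$ is a family of sets $(\Sigma_\Gamma)_{\Gamma\in\mathsf{Pos}_{\mathsf f}}$. A $\Sigma$-algebra is a poset $A$ with, for every context $\Gamma$ and every $\sigma\in\Sigma_\Gamma$, a function $\sigma_A$ (not necessarily monotone) from the set of monotone maps $\Gamma\to A$ to $A$. A homomorphism $h\colon A\to B$ is a monotone map with $h(\sigma_A(f))=\sigma_B(h\cdot f)$ for all $\sigma\in\Sigma_\Gamma$ and all monotone $f\colon\Gamma\to A$. This gives the category $\mathsf{Alg}\,\Sigma$. Terms in context $\Gamma$ are the elements of the least set that contains the elements of $\Gamma$ (the variables) and, with every $\sigma\in\Sigma_\Delta$ and every function $g$ from the underlying set of $\Delta$ to terms, contains the term $\sigma(g)$. For a $\Sigma$-algebra $A$, every monotone $f\colon\Gamma\to A$ defines a partial evaluation map $f^\#$ from the terms in context $\Gamma$ to $A$: $f^\#(x)=f(x)$ for variables $x$; and $f^\#(\sigma(g))$ is defined iff all $f^\#(g(i))$,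 $i\in\Delta$, are defined and $i\le j$ in $\Delta$ implies $f^\#(g(i))\le f^\#(g(j))$, in which case $f^\#(\sigma(g))=\sigma_A(f^\#\cdot g)$. An inequation in context $\Gamma\vdash s\le t$ is a pair of terms in context $\Gamma$; an algebra $A$ satisfies it if for every monotone $f\colon\Gamma\to A$ both $f^\#(s)$ and $f^\#(t)$ are defined and $f^\#(s)\le f^\#(t)$. A variety of $\Sigma$-algebras is the full subcategory $\mathcal V$ of $\mathsf{Alg}\,\Sigma$ of all algebras that satisfy every member of a given set $\mathcal E$ of inequations in context. Theorem. For every variety $\mathcal V$ of $\Sigma$-algebras, the forgetful functor $U\colon\mathcal V\to\mathsf{Pos}$ is monadic. In detail: 1. The forgetful functor $\mathsf{Alg}\,\Sigma\to\mathsf{Pos}$ has a left adjoint $F$, the full embedding $\mathcal V\hookrightarrow\mathsf{Alg}\,\Sigma$ has a left adjoint $R$ (so $\mathcal V$ is reflective), and $R\cdot F$ is a left adjoint of $U$. 2. $U$ creates coequalizers of $U$-split pairs. That is, let $f,g\colon A\to B$ be a pair in $\mathcal V$ such that $Uf,Ug$ has a split coequalizer in $\mathsf{Pos}$, and let $c\colon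 UB\to Z$ be any coequalizer of $Uf,Ug$. Then there is exactly one morphism $q\colon B\to Q$ in $\mathcal V$ with $q\cdot f=q\cdot g$, $UQ=Z$ and $Uq=c$, and this $q$ is a coequalizer of $f$ and $g$ in $\mathcal V$. 3. $U$ is monadic: for every left adjoint of $U$, the comparison functor from $\mathcal V$ to the Eilenberg–Moore category of the induced monad on $\mathsf{Pos}$ is an isomorphism of categories (in particular an equivalence). -/

import Mathlib

open CategoryTheory CategoryTheory.Limits

universe u v₁ v₂ u₁ u₂

/-- A set of finite posets, called *contexts* (for instance a set that represents all finite
posets up to isomorphism).  The elements of the poset `C.Var Γ` are the variables of the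
context `Γ`. -/
structure Contexts where
  /-- the set that indexes the contexts -/
  Ctx : Type u
  /-- the set of variables of a context -/
  Var : Ctx → Type u
  /-- the order on the variables of a context -/
  [order : ∀ Γ, PartialOrder (Var Γ)]
  /-- every context has finitely many variables -/
  [finite : ∀ Γ, Finite (Var Γ)]

attribute [instance] Contexts.order Contexts.finite

/-- A signature in context: for every context `Γ` a set of operation symbols of arity `Γ`. -/
structure Signature (C : Contexts.{u}) where
  /-- the set of operation symbols of arity `Γ` -/
  Op : C.Ctx → Type u

namespace Signature

variable {C : Contexts.{u}}

/-- A `Σ`-algebra: a poset `A` with, for every operation symbol `σ` of arity `Γ`, a function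
that assigns an element of `A` to every monotone map from `Γ` to `A`.  (The function need not
be monotone.) -/
structure Alg (S : Signature C) where
  /-- the underlying poset -/
  toPartOrd : PartOrd.{u}
  /-- the operations -/
  op : ∀ {Γ : C.Ctx}, S.Op Γ → (C.Var Γ →o toPartOrd) → toPartOrd

namespace Alg

variable {S : Signature C}

/-- A homomorphism of `Σ`-algebras: a monotone map that commutes with all operations. -/
@[ext]
structure Hom (A B : S.Alg) where
  /-- the underlying monotone map -/
  hom : A.toPartOrd ⟶ B.toPartOrd
  /-- compatibility with the operations -/
  map_op : ∀ {Γ : C.Ctx} (σ : S.Op Γ) (f : C.Var Γ →o A.toPartOrd),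
    hom (A.op σ f) = B.op σ (hom.hom.comp f)

/-- The category of `Σ`-algebras and homomorphisms. -/
instance : Category.{u} S.Alg where
  Hom A B := Hom A B
  id A := ⟨𝟙 A.toPartOrd, fun _ _ => rfl⟩
  comp f g := ⟨f.hom ≫ g.hom, fun σ k => by
    rw [PartOrd.comp_apply, f.map_op, g.map_op]; rfl⟩

end Alg

/-- The forgetful functor from `Σ`-algebras to posets. -/
def forget (S : Signature C) : S.Alg ⥤ PartOrd.{u} where
  obj A := A.toPartOrd
  map f := Alg.Hom.hom f

/-- `S.Term X` is the set of terms with variables from the set `X`.  The order of the arities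
is ignored: an operation symbol of arity `Δ` may be applied to every family of terms that is
indexed by the underlying set of `Δ`. -/
inductive Term (S : Signature C) (X : Type u) : Type u
  | var : X → Term S X
  | app : {Δ : C.Ctx} → S.Op Δ → (C.Var Δ → Term S X) → Term S X

/-- The evaluation of terms in context `Γ` at a monotone interpretation `f` of the variables,
as a partial map: the value of `σ(g)` is defined iff the values of all `g i` are defined and
depend monotonically on `i`. -/
def eval {S : Signature C} (A : S.Alg) {Γ : C.Ctx} (f : C.Var Γ →o A.toPartOrd) :
    S.Term (C.Var Γ) → Part A.toPartOrd
  | .var x => Part.some (f x)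
  | .app σ g =>
    { Dom := ∃ h : ∀ i, (eval A f (g i)).Dom, Monotone fun i => (eval A f (g i)).get (h i)
      get := fun h => A.op σ ⟨fun i => (eval A f (g i)).get (h.fst i), h.snd⟩ }

/-- An inequation in context `Γ ⊢ s ≤ t`. -/
structure Inequation (S : Signature C) where
  /-- the context -/
  ctx : C.Ctx
  /-- the smaller term -/
  lhs : S.Term (C.Var ctx)
  /-- the larger term -/
  rhs : S.Term (C.Var ctx)

/-- An algebra satisfies `Γ ⊢ s ≤ t` if, for every monotone interpretation of the variables,
the values of `s` and `t` are both defined and the first one is below the second one. -/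
def Alg.Satisfies {S : Signature C} (A : S.Alg) (e : S.Inequation) : Prop :=
  ∀ f : C.Var e.ctx →o A.toPartOrd,
    ∃ (hs : (eval A f e.lhs).Dom) (ht : (eval A f e.rhs).Dom),
      (eval A f e.lhs).get hs ≤ (eval A f e.rhs).get ht

/-- The property of being an algebra of the variety presented by the set `E` of inequations. -/
def isModel (S : Signature C) (E : Set S.Inequation) : ObjectProperty S.Alg :=
  fun A => ∀ e ∈ E, A.Satisfies e

/-- The variety presented by `E`: the full subcategory of all algebras that satisfy every
inequation in `E`. -/
abbrev Variety (S : Signature C) (E : Set S.Inequation) : Type (u + 1) :=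
  (S.isModel E).FullSubcategory

/-- The full embedding of a variety into the category of `Σ`-algebras. -/
abbrev varietyInclusion (S : Signature C) (E : Set S.Inequation) : S.Variety E ⥤ S.Alg :=
  (S.isModel E).ι

/-- The forgetful functor from a variety to posets. -/
abbrev varietyForget (S : Signature C) (E : Set S.Inequation) : S.Variety E ⥤ PartOrd.{u} :=
  S.varietyInclusion E ⋙ S.forget

end Signature

/-- `U` (strictly) creates coequalizers of `U`-split pairs: if `f, g : A ⟶ B` is a `U`-split pair
and `c : U B ⟶ Z` is a coequalizer of `U f` and `U g`, then there is exactly one morphism `q`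
with domain `B` that coequalizes `f` and `g` and that `U` sends to `c` (in particular its codomain
to `Z`), and this `q` is a coequalizer of `f` and `g`. -/
def CreatesSplitCoequalizers {𝒟 : Type u₁} [Category.{v₁} 𝒟] {𝒞 : Type u₂} [Category.{v₂} 𝒞]
    (U : 𝒟 ⥤ 𝒞) : Prop :=
  ∀ ⦃A B : 𝒟⦄ (f g : A ⟶ B), U.IsSplitPair f g →
    ∀ (Z : 𝒞) (c : U.obj B ⟶ Z) (w : U.map f ≫ c = U.map g ≫ c),
      Nonempty (IsColimit (Cofork.ofπ c w)) →
        (∃! q : (Q : 𝒟) × (B ⟶ Q), f ≫ q.2 = g ≫ q.2 ∧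
          (⟨U.obj q.1, U.map q.2⟩ : (Y : 𝒞) × (U.obj B ⟶ Y)) = ⟨Z, c⟩) ∧
        ∀ (Q : 𝒟) (q : B ⟶ Q) (h : f ≫ q = g ≫ q),
          (⟨U.obj Q, U.map q⟩ : (Y : 𝒞) × (U.obj B ⟶ Y)) = ⟨Z, c⟩ →
            Nonempty (IsColimit (Cofork.ofπ q h))

/-- A functor is an isomorphism of categories: it has a strict two-sided inverse. -/
def IsCategoryIso {𝒟 : Type u₁} [Category.{v₁} 𝒟] {𝒞 : Type u₂} [Category.{v₂} 𝒞]
    (K : 𝒟 ⥤ 𝒞) : Prop :=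
  ∃ L : 𝒞 ⥤ 𝒟, K ⋙ L = 𝟭 𝒟 ∧ L ⋙ K = 𝟭 𝒞

/-!
The terms that are defined under every member of a given family of interpretations `X ⟶ A i`,
identified when all their values agree, form the subalgebra of `∏ A i` generated by `X`.  It is
small however large the family is, because there is only a set of terms.  For all interpretations
of `X` it is the free algebra; for all homomorphisms from an algebra `B` to members of the variety
it is the reflection of `B`, since satisfaction of an inequation passes to subalgebras of products.

A coequalizer of a `U`-split pair is a retraction `c` with a monotone section `s`, and the split
identities show that `σ(k) = c (σ (s ∘ k))` is the only algebra structure making `c` a homomorphism.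
Every inequation survives, because an interpretation in the quotient is the `c`-image of its
composite with `s`.  Monadicity is then Beck's theorem, and strict uniqueness of the lifts makes the
comparison functor bijective on objects.
-/

section Beck

variable {𝒟 : Type u₁} [Category.{v₁} 𝒟] {𝒞 : Type u₂} [Category.{v₂} 𝒞]

theorem IsCategoryIso.of_bijective_obj (K : 𝒟 ⥤ 𝒞) [K.Full] [K.Faithful]
    (hK : Function.Bijective K.obj) : IsCategoryIso K := by
  let e := Equiv.ofBijective K.obj hK
  have hKe : ∀ Y, K.obj (e.symm Y) = Y := e.apply_symm_apply
  have heK : ∀ X, e.symm (K.obj X) = X := e.symm_apply_apply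
  let L : 𝒞 ⥤ 𝒟 :=
    { obj := fun Y => e.symm Y
      map := fun {Y Z} f => K.preimage (eqToHom (hKe Y) ≫ f ≫ eqToHom (hKe Z).symm)
      map_id := fun Y => K.map_injective (by simp)
      map_comp := fun f g => K.map_injective (by simp) }
  refine ⟨L, CategoryTheory.Functor.ext heK fun X Y f => K.map_injective ?_,
    CategoryTheory.Functor.ext hKe fun Y Z f => by simp [L]⟩
  calc K.map (L.map (K.map f)) =
        eqToHom (hKe (K.obj X)) ≫ K.map f ≫ eqToHom (hKe (K.obj Y)).symm := K.map_preimage _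
    _ = K.map (eqToHom (heK X) ≫ f ≫ eqToHom (heK Y).symm) := by simp [eqToHom_map]

/-- The morphism `q` lies over `c`: the functor `U` sends the codomain of `q` to the codomain of
`c`, and `q` to `c`. -/
abbrev LiesOver (U : 𝒟 ⥤ 𝒞) {B Q : 𝒟} (q : B ⟶ Q) {Z : 𝒞} (c : U.obj B ⟶ Z) : Prop :=
  (⟨U.obj Q, U.map q⟩ : (Y : 𝒞) × (U.obj B ⟶ Y)) = ⟨Z, c⟩

theorem nonempty_isSplitCoequalizer_of_isColimit {X Y Z : 𝒞} {f g : X ⟶ Y}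
    (hfg : HasSplitCoequalizer f g) {c : Y ⟶ Z} {w : f ≫ c = g ≫ c}
    (hc : IsColimit (Cofork.ofπ c w)) : Nonempty (IsSplitCoequalizer f g c) := by
  obtain ⟨W, p, ⟨h⟩⟩ := hfg.splittable
  obtain ⟨d, hd⟩ : {d // c ≫ d = p} := Cofork.IsColimit.desc' hc p h.condition
  refine ⟨⟨d ≫ h.rightSection, h.leftSection, w, Cofork.IsColimit.hom_ext hc ?_,
    h.leftSection_bottom, ?_⟩⟩
  · calc c ≫ (d ≫ h.rightSection) ≫ c = h.leftSection ≫ f ≫ c := by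
          rw [Category.assoc, reassoc_of% hd, ← h.leftSection_top_assoc]
      _ = c ≫ 𝟙 Z := by rw [w, h.leftSection_bottom_assoc, Category.comp_id]
  · rw [h.leftSection_top, reassoc_of% hd]

variable {U : 𝒟 ⥤ 𝒞} {F : 𝒞 ⥤ 𝒟} (adj : F ⊣ U)

/-- The unit law of an algebra forces a lift of its structure map to be the counit. -/
theorem comparison_obj_eq_iff (X : adj.toMonad.Algebra) (Q : 𝒟) :
    (Monad.comparison adj).obj Q = X ↔ ∃ q : F.obj X.A ⟶ Q,
      F.map X.a ≫ q = adj.counit.app (F.obj X.A) ≫ q ∧ LiesOver U q X.a := by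
  constructor
  · rintro rfl
    exact ⟨adj.counit.app Q, adj.counit_naturality _, rfl⟩
  · rintro ⟨q, -, hq⟩
    obtain ⟨Z, a, hunit, hassoc⟩ := X
    dsimp at q hq hunit
    obtain ⟨rfl, hqa⟩ := Sigma.mk.inj hq
    obtain rfl := eq_of_heq hqa
    obtain rfl : q = adj.counit.app Q := (adj.homEquiv _ _).injective <| by
      rw [adj.homEquiv_unit, adj.homEquiv_unit, adj.right_triangle_components]
      exact hunit
    rfl

theorem CreatesSplitCoequalizers.bijective_comparison_obj (hU : CreatesSplitCoequalizers U) :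
    Function.Bijective (Monad.comparison adj).obj := by
  refine (Function.bijective_iff_existsUnique _).2 fun X => ?_
  let h := Monad.beckSplitCoequalizer X
  obtain ⟨⟨⟨Q, q⟩, hq, huniq⟩, -⟩ :=
    hU (F.map X.a) (adj.counit.app (F.obj X.A)) ⟨_, _, ⟨h⟩⟩ X.A X.a h.condition
      ⟨h.isCoequalizer⟩
  refine ⟨Q, (comparison_obj_eq_iff adj X Q).2 ⟨q, hq⟩, fun Q' hQ' => ?_⟩
  obtain ⟨q', hq'⟩ := (comparison_obj_eq_iff adj X Q').1 hQ'
  exact congrArg Sigma.fst (huniq ⟨Q', q'⟩ hq')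

end Beck

namespace CreatesSplitCoequalizers

variable {𝒟 : Type u₁} [Category.{v₁} 𝒟] {𝒞 : Type u₂} [Category.{v₁} 𝒞]
variable {U : 𝒟 ⥤ 𝒞}

theorem exists_isColimit (hU : CreatesSplitCoequalizers U) {A B : 𝒟} (f g : A ⟶ B)
    [U.IsSplitPair f g] :
    ∃ (Q : 𝒟) (q : B ⟶ Q) (w : f ≫ q = g ≫ q), Nonempty (IsColimit (Cofork.ofπ q w)) ∧
      Nonempty (IsColimit (U.mapCocone (Cofork.ofπ q w))) := by
  obtain ⟨Z, c, ⟨h⟩⟩ := HasSplitCoequalizer.splittable (f := U.map f) (g := U.map g)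
  obtain ⟨⟨⟨Q, q⟩, ⟨w, hq⟩, -⟩, hcolim⟩ :=
    hU f g inferInstance Z c h.condition ⟨h.isCoequalizer⟩
  refine ⟨Q, q, w, hcolim Q q w hq, ⟨(isColimitMapCoconeCoforkEquiv U w).symm ?_⟩⟩
  obtain ⟨rfl, hqc⟩ := Sigma.mk.inj hq
  obtain rfl := eq_of_heq hqc
  exact h.isCoequalizer

theorem hasCoequalizerOfIsSplitPair (hU : CreatesSplitCoequalizers U) :
    Monad.HasCoequalizerOfIsSplitPair U where
  out f g _ :=
    let ⟨_, _, _, ⟨h⟩, _⟩ := hU.exists_isColimit f g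
    ⟨⟨⟨_, h⟩⟩⟩

theorem preservesColimitOfIsSplitPair (hU : CreatesSplitCoequalizers U) :
    Monad.PreservesColimitOfIsSplitPair U where
  out f g _ :=
    let ⟨_, _, _, ⟨h⟩, ⟨h'⟩⟩ := hU.exists_isColimit f g
    preservesColimit_of_preserves_colimit_cocone h h'

theorem reflectsColimitOfIsSplitPair (hU : CreatesSplitCoequalizers U) :
    Monad.ReflectsColimitOfIsSplitPair U where
  out f g _ := ⟨fun {t} ht => by
    let e : t ≅ Cofork.ofπ (Cofork.π t) (Cofork.condition t) := Cofork.isoCoforkOfπ t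
    have hmap := (IsColimit.equivIsoColimit ((Cocone.functoriality _ U).mapIso e)) ht
    obtain ⟨h⟩ := (hU f g inferInstance _ _ _ ⟨isColimitMapCoconeCoforkEquiv U _ hmap⟩).2
      _ _ (Cofork.condition t) rfl
    exact ⟨(IsColimit.equivIsoColimit e).symm h⟩⟩

variable {F : 𝒞 ⥤ 𝒟} (adj : F ⊣ U)

/-- A right adjoint that strictly creates coequalizers of split pairs is monadic. -/
noncomputable abbrev monadicRightAdjoint (hU : CreatesSplitCoequalizers U) :
    MonadicRightAdjoint U :=
  have := hU.hasCoequalizerOfIsSplitPair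
  have := hU.preservesColimitOfIsSplitPair
  have := hU.reflectsColimitOfIsSplitPair
  Monad.monadicOfHasPreservesReflectsGSplitCoequalizers adj

theorem isEquivalence_comparison (hU : CreatesSplitCoequalizers U) :
    (Monad.comparison adj).IsEquivalence :=
  (hU.monadicRightAdjoint adj).eqv

theorem isCategoryIso_comparison (hU : CreatesSplitCoequalizers U) :
    IsCategoryIso (Monad.comparison adj) :=
  have := hU.isEquivalence_comparison adj
  .of_bijective_obj _ (hU.bijective_comparison_obj adj)

end CreatesSplitCoequalizers

namespace Signature

variable {C : Contexts.{u}} {S : Signature C}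

section Evaluation

/-- `A.Evaluates f t a` says that the term `t` has the value `a` in the algebra `A` if its
variables are interpreted by `f`.  In contrast to `eval`, the variables form an arbitrary set, so
that terms over the generators of a free algebra are covered. -/
inductive Alg.Evaluates (A : S.Alg) {X : Type u} (f : X → A.toPartOrd) :
    S.Term X → A.toPartOrd → Prop
  | var (x : X) : Evaluates A f (.var x) (f x)
  | app {Δ : C.Ctx} (σ : S.Op Δ) (g : C.Var Δ → S.Term X) (k : C.Var Δ →o A.toPartOrd)
      (h : ∀ i, Evaluates A f (g i) (k i)) : Evaluates A f (.app σ g) (A.op σ k)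

namespace Alg.Evaluates

variable {A B : S.Alg} {X : Type u} {f : X → A.toPartOrd}

theorem var_iff {x : X} {a : A.toPartOrd} : A.Evaluates f (.var x) a ↔ a = f x :=
  ⟨fun h => by cases h; rfl, fun h => h ▸ .var x⟩

theorem app_iff {Δ : C.Ctx} {σ : S.Op Δ} {g : C.Var Δ → S.Term X} {a : A.toPartOrd} :
    A.Evaluates f (.app σ g) a ↔
      ∃ k : C.Var Δ →o A.toPartOrd, (∀ i, A.Evaluates f (g i) (k i)) ∧ A.op σ k = a :=
  ⟨fun h => by cases h with | app _ _ k h => exact ⟨k, h, rfl⟩,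
    fun ⟨k, h, e⟩ => e ▸ .app σ g k h⟩

theorem unique {t : S.Term X} {a b : A.toPartOrd} (ha : A.Evaluates f t a)
    (hb : A.Evaluates f t b) : a = b := by
  induction ha generalizing b with
  | var x => exact (var_iff.1 hb).symm
  | app σ g k _ ih =>
    obtain ⟨l, hl, rfl⟩ := app_iff.1 hb
    exact congrArg _ (OrderHom.ext _ _ (funext fun i => ih i (hl i)))

theorem map (φ : A ⟶ B) {t : S.Term X} {a : A.toPartOrd} (h : A.Evaluates f t a) :
    B.Evaluates (φ.hom ∘ f) t (φ.hom a) := by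
  induction h with
  | var x => exact .var x
  | app σ g k _ ih =>
    rw [φ.map_op]
    exact .app σ g _ ih

end Alg.Evaluates

theorem mem_eval_iff {A : S.Alg} {Γ : C.Ctx} {f : C.Var Γ →o A.toPartOrd}
    {t : S.Term (C.Var Γ)} {a : A.toPartOrd} : a ∈ eval A f t ↔ A.Evaluates f t a := by
  induction t generalizing a with
  | var x => rw [eval, Part.mem_some_iff, Alg.Evaluates.var_iff]
  | app σ g ih =>
    rw [eval, Alg.Evaluates.app_iff]
    constructor
    · rintro ⟨⟨h, hmono⟩, rfl⟩
      exact ⟨⟨_, hmono⟩, fun i => (ih i).1 (Part.get_mem (h i)), rfl⟩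
    · rintro ⟨k, hk, rfl⟩
      have hdom : ∀ i, (eval A f (g i)).Dom := fun i => ((ih i).2 (hk i)).1
      have hget : (fun i => (eval A f (g i)).get (hdom i)) = k :=
        funext fun i => Part.get_eq_of_mem ((ih i).2 (hk i)) (hdom i)
      exact ⟨⟨hdom, by rw [hget]; exact k.monotone⟩, congrArg _ (OrderHom.ext _ _ hget)⟩

theorem satisfies_iff {A : S.Alg} {e : S.Inequation} :
    A.Satisfies e ↔ ∀ f : C.Var e.ctx →o A.toPartOrd,
      ∃ a b, A.Evaluates f e.lhs a ∧ A.Evaluates f e.rhs b ∧ a ≤ b := by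
  refine forall_congr' fun f => ⟨?_, ?_⟩
  · rintro ⟨hs, ht, h⟩
    exact ⟨_, _, mem_eval_iff.1 (Part.get_mem hs), mem_eval_iff.1 (Part.get_mem ht), h⟩
  · rintro ⟨a, b, ha, hb, h⟩
    obtain ⟨hs, rfl⟩ := mem_eval_iff.2 ha
    obtain ⟨ht, rfl⟩ := mem_eval_iff.2 hb
    exact ⟨hs, ht, h⟩

end Evaluation

section JointlyReflect

/-- The homomorphisms `φ i` jointly reflect the order, that is, they embed `B` into the product of
the algebras `A i`. -/
def Alg.JointlyReflect {ι : Type*} {A : ι → S.Alg} {B : S.Alg} (φ : ∀ i, B ⟶ A i) : Prop :=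
  ∀ ⦃x y : B.toPartOrd⦄, (∀ i, (φ i).hom x ≤ (φ i).hom y) → x ≤ y

namespace Alg.JointlyReflect

variable {ι : Type*} {A : ι → S.Alg} {B : S.Alg} {φ : ∀ i, B ⟶ A i}

theorem eq_of_forall (hφ : JointlyReflect φ) {x y : B.toPartOrd}
    (h : ∀ i, (φ i).hom x = (φ i).hom y) : x = y :=
  le_antisymm (hφ fun i => (h i).le) (hφ fun i => (h i).ge)

theorem exists_evaluates_iff (hφ : JointlyReflect φ) {X : Type u} {p : X → B.toPartOrd}
    {t : S.Term X} :
    (∃ b, B.Evaluates p t b) ↔ ∀ i, ∃ a, (A i).Evaluates ((φ i).hom ∘ p) t a := by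
  refine ⟨fun ⟨b, hb⟩ i => ⟨_, hb.map (φ i)⟩, fun ht => ?_⟩
  induction t with
  | var x => exact ⟨_, .var x⟩
  | app σ g ih =>
    simp only [Evaluates.app_iff] at ht
    choose _ k hk _ using ht
    choose b hb using fun j => ih j fun i => ⟨_, hk i j⟩
    have hbk (i : ι) (j) : (φ i).hom (b j) = k i j := ((hb j).map (φ i)).unique (hk i j)
    refine ⟨_, .app σ g ⟨b, fun j l hjl => hφ fun i => ?_⟩ hb⟩
    rw [hbk, hbk]
    exact (k i).monotone hjl

theorem evaluates_iff (hφ : JointlyReflect φ) {X : Type u} {p : X → B.toPartOrd}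
    {t : S.Term X} {b : B.toPartOrd} :
    B.Evaluates p t b ↔ ∀ i, (A i).Evaluates ((φ i).hom ∘ p) t ((φ i).hom b) := by
  refine ⟨fun hb i => hb.map (φ i), fun hb => ?_⟩
  obtain ⟨b', hb'⟩ := hφ.exists_evaluates_iff.2 fun i => ⟨_, hb i⟩
  rwa [hφ.eq_of_forall fun i => (hb i).unique (hb'.map (φ i))]

theorem isModel (hφ : JointlyReflect φ) {E : Set S.Inequation} (hA : ∀ i, S.isModel E (A i)) :
    S.isModel E B := by
  refine fun e he => satisfies_iff.2 fun p => ?_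
  have hsat (i : ι) := satisfies_iff.1 (hA i e he) ((φ i).hom.hom.comp p)
  choose a b ha hb hab using hsat
  obtain ⟨s, hs⟩ := hφ.exists_evaluates_iff.2 fun i => ⟨_, ha i⟩
  obtain ⟨t, ht⟩ := hφ.exists_evaluates_iff.2 fun i => ⟨_, hb i⟩
  refine ⟨s, t, hs, ht, hφ fun i => ?_⟩
  rw [(hs.map (φ i)).unique (ha i), (ht.map (φ i)).unique (hb i)]
  exact hab i

end Alg.JointlyReflect

end JointlyReflect

section Generated

variable {X : PartOrd.{u}} {ι : Type*} {A : ι → S.Alg} (f : ∀ i, X ⟶ (A i).toPartOrd)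

/-- The terms over `X` that have a value under all interpretations `f i`. -/
def DefinedTerm : Type u :=
  {t : S.Term X // ∀ i, ∃ a, (A i).Evaluates (f i) t a}

namespace DefinedTerm

variable {f}

/-- The value of a defined term under the interpretation `f i`. -/
noncomputable def value (i : ι) (t : DefinedTerm f) : (A i).toPartOrd :=
  (t.2 i).choose

theorem evaluates_value (i : ι) (t : DefinedTerm f) : (A i).Evaluates (f i) t.1 (value i t) :=
  (t.2 i).choose_spec

/-- Terms are compared by their values under all interpretations, so that the identification of
equivalent terms yields a subposet of the product of the `A i`. -/
noncomputable instance : Preorder (DefinedTerm f) :=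
  Preorder.lift fun t i => value i t

/-- The value of a defined term under the interpretation `f i`, as a monotone map. -/
noncomputable def valueHom (i : ι) : DefinedTerm f →o (A i).toPartOrd :=
  ⟨value i, fun _ _ h => h i⟩

variable (f) in
/-- A variable as a defined term. -/
def var (x : X) : DefinedTerm f :=
  ⟨.var x, fun _ => ⟨_, .var x⟩⟩

theorem value_var (i : ι) (x : X) : value i (var f x) = f i x :=
  Alg.Evaluates.var_iff.1 (evaluates_value i (var f x))

/-- The application of an operation symbol to a monotone family of defined terms. -/
noncomputable def app {Δ : C.Ctx} (σ : S.Op Δ) (g : C.Var Δ →o DefinedTerm f) : DefinedTerm f :=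
  ⟨.app σ fun j => (g j).1, fun i =>
    ⟨_, .app σ _ ((valueHom i).comp g) fun j => evaluates_value i (g j)⟩⟩

theorem value_app (i : ι) {Δ : C.Ctx} (σ : S.Op Δ) (g : C.Var Δ →o DefinedTerm f) :
    value i (app σ g) = (A i).op σ ((valueHom i).comp g) :=
  (evaluates_value i (app σ g)).unique (.app σ _ _ fun j => evaluates_value i (g j))

theorem value_ofAntisymmetrization (i : ι) (t : DefinedTerm f) :
    value i (ofAntisymmetrization (· ≤ ·) (toAntisymmetrization (· ≤ ·) t)) = value i t := by
  have h : AntisymmRel (· ≤ ·) (ofAntisymmetrization (· ≤ ·) (toAntisymmetrization (· ≤ ·) t)) t :=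
    Quotient.exact (toAntisymmetrization_ofAntisymmetrization _ _)
  exact le_antisymm (h.1 i) (h.2 i)

end DefinedTerm

/-- The subalgebra of the product of the algebras `A i` that is generated by the image of `X`,
realized as a quotient of a set of terms so that it is small for every family of algebras. -/
noncomputable def generatedAlg : S.Alg where
  toPartOrd := .of (Antisymmetrization (DefinedTerm f) (· ≤ ·))
  op σ k := toAntisymmetrization _ (DefinedTerm.app σ
    ((OrderEmbedding.ofAntisymmetrization (DefinedTerm f)).toOrderHom.comp k))

namespace generatedAlg

/-- The interpretation of the generators in the generated algebra. -/
noncomputable def unit : X ⟶ (generatedAlg f).toPartOrd :=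
  PartOrd.ofHom ⟨fun x => toAntisymmetrization _ (DefinedTerm.var f x), fun x y hxy i => by
    change DefinedTerm.value i _ ≤ DefinedTerm.value i _
    rw [DefinedTerm.value_var, DefinedTerm.value_var]
    exact (f i).hom.monotone hxy⟩

/-- The restriction of a projection of the product to the generated algebra. -/
noncomputable def proj (i : ι) : generatedAlg f ⟶ A i where
  hom := PartOrd.ofHom ((DefinedTerm.valueHom i).comp
    (OrderEmbedding.ofAntisymmetrization (DefinedTerm f)).toOrderHom)
  map_op σ _ := (DefinedTerm.value_ofAntisymmetrization i _).trans (DefinedTerm.value_app i σ _)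

theorem proj_toAntisymmetrization (i : ι) (t : DefinedTerm f) :
    (proj f i).hom (toAntisymmetrization (· ≤ ·) t) = t.value i :=
  DefinedTerm.value_ofAntisymmetrization i t

theorem unit_comp_proj (i : ι) : unit f ≫ (proj f i).hom = f i :=
  PartOrd.ext fun x =>
    (proj_toAntisymmetrization f i (.var f x)).trans (DefinedTerm.value_var i x)

theorem jointlyReflect_proj : Alg.JointlyReflect (proj f) := fun _ _ h =>
  (OrderEmbedding.ofAntisymmetrization (DefinedTerm f)).le_iff_le.1 h

theorem evaluates_unit (t : DefinedTerm f) :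
    (generatedAlg f).Evaluates (unit f) t.1 (toAntisymmetrization (· ≤ ·) t) := by
  refine (jointlyReflect_proj f).evaluates_iff.2 fun i => ?_
  rw [← PartOrd.coe_comp, unit_comp_proj, proj_toAntisymmetrization]
  exact DefinedTerm.evaluates_value i t

variable {f}

theorem hom_ext {B : S.Alg} {φ ψ : generatedAlg f ⟶ B}
    (h : unit f ≫ φ.hom = unit f ≫ ψ.hom) : φ = ψ := by
  refine Alg.Hom.ext (PartOrd.ext fun x => ?_)
  induction x using Antisymmetrization.ind with | _ t
  have hφ := (evaluates_unit f t).map φ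
  have hψ := (evaluates_unit f t).map ψ
  rw [← PartOrd.coe_comp, h] at hφ
  exact hφ.unique hψ

/-- A family of homomorphisms out of an algebra factors through the subalgebra of the product that
is generated by the image. -/
noncomputable def lift {B : S.Alg} (φ : ∀ i, B ⟶ A i) : B ⟶ generatedAlg fun i => (φ i).hom where
  hom := unit _
  map_op σ k := (jointlyReflect_proj _).eq_of_forall fun i => by
    have hk : (φ i).hom.hom.comp k =
        (proj _ i).hom.hom.comp ((unit fun i => (φ i).hom).hom.comp k) := by
      rw [← OrderHom.comp_assoc, ← PartOrd.hom_comp, unit_comp_proj]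
    rw [(proj _ i).map_op, ← PartOrd.comp_apply, unit_comp_proj, (φ i).map_op, hk]

end generatedAlg

end Generated

section Adjoints

open generatedAlg

variable (S) in
/-- The free algebra on a poset `X`, generated by `X` in the product of all algebras with an
interpretation of `X`. -/
noncomputable def freeAlg (X : PartOrd.{u}) : S.Alg :=
  generatedAlg fun i : (A : S.Alg) × (X ⟶ A.toPartOrd) => i.2

/-- The universal property of the free algebra. -/
noncomputable def freeAlgHomEquiv (X : PartOrd.{u}) (A : S.Alg) :
    (S.freeAlg X ⟶ A) ≃ (X ⟶ S.forget.obj A) where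
  toFun φ := unit _ ≫ φ.hom
  invFun f := proj (fun i : (A : S.Alg) × (X ⟶ A.toPartOrd) => i.2) ⟨A, f⟩
  left_inv _ := hom_ext (unit_comp_proj _ _)
  right_inv _ := unit_comp_proj _ _

variable (S) in
/-- The free algebra functor. -/
noncomputable def free : PartOrd.{u} ⥤ S.Alg :=
  Adjunction.leftAdjointOfEquiv (G := S.forget) freeAlgHomEquiv fun _ _ _ _ _ => rfl

variable (S) in
/-- Free algebras are left adjoint to the forgetful functor. -/
noncomputable def freeAdjunction : S.free ⊣ S.forget :=
  Adjunction.adjunctionOfEquivLeft freeAlgHomEquiv fun _ _ _ _ _ => rfl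

variable (E : Set S.Inequation)

/-- The reflection of an algebra `B` in a variety, generated by `B` in the product of all algebras
of the variety with a homomorphism from `B`. -/
noncomputable def reflection (B : S.Alg) : S.Variety E where
  obj := generatedAlg fun i : (A : S.Variety E) × (B ⟶ A.obj) => i.2.hom
  property := (jointlyReflect_proj _).isModel fun i => i.1.property

/-- The universal property of the reflection. -/
noncomputable def reflectionHomEquiv (B : S.Alg) (A : S.Variety E) :
    (reflection E B ⟶ A) ≃ (B ⟶ (S.varietyInclusion E).obj A) where
  toFun φ := lift (fun i : (A : S.Variety E) × (B ⟶ A.obj) => i.2) ≫ φ.hom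
  invFun ψ := ObjectProperty.homMk
    (proj (fun i : (A : S.Variety E) × (B ⟶ A.obj) => i.2.hom) ⟨A, ψ⟩)
  left_inv _ := ObjectProperty.hom_ext _ (hom_ext (unit_comp_proj _ _))
  right_inv _ := Alg.Hom.ext (unit_comp_proj _ _)

/-- The reflector of the category of algebras into a variety. -/
noncomputable def reflector : S.Alg ⥤ S.Variety E :=
  Adjunction.leftAdjointOfEquiv (G := S.varietyInclusion E) (reflectionHomEquiv E)
    fun _ _ _ _ _ => rfl

/-- The reflector is left adjoint to the embedding of the variety. -/
noncomputable def reflectorAdjunction : reflector E ⊣ S.varietyInclusion E :=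
  Adjunction.adjunctionOfEquivLeft (reflectionHomEquiv E) fun _ _ _ _ _ => rfl

end Adjoints

section SplitCoequalizers

variable {B Q W : S.Alg} {Z : PartOrd.{u}}

theorem comp_section_comp {α : Type*} [Preorder α] {Y : PartOrd.{u}} {c : Y ⟶ Z} {s : Z ⟶ Y}
    (hs : s ≫ c = 𝟙 Z) (k : α →o Z) : c.hom.comp (s.hom.comp k) = k := by
  rw [← OrderHom.comp_assoc, ← PartOrd.hom_comp, hs, PartOrd.hom_id, OrderHom.id_comp]

/-- The algebra structure on a retract `c : B ⟶ Z`, `s : Z ⟶ B` of the poset of an algebra `B`. -/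
def Alg.retract (B : S.Alg) (c : B.toPartOrd ⟶ Z) (s : Z ⟶ B.toPartOrd) : S.Alg where
  toPartOrd := Z
  op σ k := c (B.op σ (s.hom.comp k))

/-- The coequalizing map of a split coequalizer of homomorphisms is a homomorphism. -/
def Alg.toRetract {A : S.Alg} {f g : A ⟶ B} {c : B.toPartOrd ⟶ Z}
    (h : IsSplitCoequalizer f.hom g.hom c) : B ⟶ B.retract c h.rightSection where
  hom := c
  map_op σ k := by
    let l := h.leftSection.hom.comp k
    have hg : g.hom.hom.comp l = k := comp_section_comp h.leftSection_bottom k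
    have hf : f.hom.hom.comp l = h.rightSection.hom.comp (c.hom.comp k) := by
      rw [← OrderHom.comp_assoc, ← OrderHom.comp_assoc, ← PartOrd.hom_comp, ← PartOrd.hom_comp,
        h.leftSection_top]
    calc c (B.op σ k) = c (g.hom (A.op σ l)) := by rw [g.map_op, hg]
      _ = c (f.hom (A.op σ l)) := (ConcreteCategory.congr_hom h.condition (A.op σ l)).symm
      _ = c (B.op σ (h.rightSection.hom.comp (c.hom.comp k))) := by rw [f.map_op, hf]

section SectionOfHom

variable (q : B ⟶ Q) {s : Q.toPartOrd ⟶ B.toPartOrd} (hs : s ≫ q.hom = 𝟙 Q.toPartOrd)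
include hs

theorem op_eq_of_section {Γ : C.Ctx} (σ : S.Op Γ) (k : C.Var Γ →o Q.toPartOrd) :
    Q.op σ k = q.hom (B.op σ (s.hom.comp k)) := by
  rw [q.map_op, comp_section_comp hs]

theorem isModel_of_section {E : Set S.Inequation} (hB : S.isModel E B) : S.isModel E Q := by
  refine fun e he => satisfies_iff.2 fun p => ?_
  obtain ⟨a, b, ha, hb, hab⟩ := satisfies_iff.1 (hB e he) (s.hom.comp p)
  have hp : q.hom ∘ s.hom.comp p = p := congrArg DFunLike.coe (comp_section_comp hs p)
  exact ⟨_, _, hp ▸ ha.map q, hp ▸ hb.map q, q.hom.hom.monotone hab⟩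

/-- A monotone map is a homomorphism if its composite with a homomorphism `q` is one and `q` has a
monotone section. -/
def Alg.homOfCompEq (φ : B ⟶ W) (m : Q.toPartOrd ⟶ W.toPartOrd) (hm : q.hom ≫ m = φ.hom) :
    Q ⟶ W where
  hom := m
  map_op σ k := by
    calc m (Q.op σ k) = φ.hom (B.op σ (s.hom.comp k)) := by
          rw [op_eq_of_section q hs, ← hm, PartOrd.comp_apply]
      _ = W.op σ (m.hom.comp (q.hom.hom.comp (s.hom.comp k))) := by
          rw [φ.map_op, ← hm, PartOrd.hom_comp, OrderHom.comp_assoc]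
      _ = W.op σ (m.hom.comp k) := by rw [comp_section_comp hs]

end SectionOfHom

namespace Variety

variable {E : Set S.Inequation} {A B Q Q' : S.Variety E}

theorem sigma_eq_of_liesOver (q : B ⟶ Q) {s : Q.obj.toPartOrd ⟶ B.obj.toPartOrd}
    (hs : s ≫ q.hom.hom = 𝟙 _) (q' : B ⟶ Q') (h : LiesOver (S.varietyForget E) q' q.hom.hom) :
    (⟨Q', q'⟩ : (Q : S.Variety E) × (B ⟶ Q)) = ⟨Q, q⟩ := by
  obtain ⟨⟨Z, op⟩, hQ⟩ := Q
  obtain ⟨⟨Z', op'⟩, hQ'⟩ := Q'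
  obtain ⟨q⟩ := q
  obtain ⟨q'⟩ := q'
  obtain ⟨hZ, hq⟩ := Sigma.mk.inj h
  dsimp only [Functor.comp_obj, forget, ObjectProperty.ι_obj] at hZ
  subst hZ
  replace hq : q'.hom = q.hom := eq_of_heq hq
  obtain rfl : @op = @op' := by
    funext Γ σ k
    have h := op_eq_of_section q hs σ k
    have h' := op_eq_of_section q' (hq ▸ hs) σ k
    rw [hq] at h'
    exact h.trans h'.symm
  obtain rfl : q' = q := Alg.Hom.ext hq
  rfl

/-- A homomorphism is a coequalizer if its underlying map is one and has a section. -/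
def isColimitOfSection {f g : A ⟶ B} {q : B ⟶ Q} (w : f ≫ q = g ≫ q)
    {s : Q.obj.toPartOrd ⟶ B.obj.toPartOrd} (hs : s ≫ q.hom.hom = 𝟙 _)
    (hq : IsColimit ((S.varietyForget E).mapCocone (Cofork.ofπ q w))) :
    IsColimit (Cofork.ofπ q w) := by
  have hc := isColimitMapCoconeCoforkEquiv _ w hq
  refine Cofork.IsColimit.mk' _ fun t => ?_
  have ht : f.hom.hom ≫ t.π.hom.hom = g.hom.hom ≫ t.π.hom.hom :=
    congrArg (S.varietyForget E).map t.condition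
  obtain ⟨m, hm⟩ := Cofork.IsColimit.desc' hc t.π.hom.hom ht
  refine ⟨ObjectProperty.homMk (Alg.homOfCompEq q.hom hs t.π.hom m hm),
    ObjectProperty.hom_ext _ (Alg.Hom.ext hm), fun {m'} hm' => ?_⟩
  refine ObjectProperty.hom_ext _ (Alg.Hom.ext (Cofork.IsColimit.hom_ext hc ?_))
  exact (congrArg (S.varietyForget E).map hm').trans hm.symm

end Variety

theorem varietyForget_createsSplitCoequalizers (E : Set S.Inequation) :
    CreatesSplitCoequalizers (S.varietyForget E) := by
  intro A B f g hfg Z c w ⟨hc⟩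
  obtain ⟨h⟩ := nonempty_isSplitCoequalizer_of_isColimit hfg hc
  replace h : IsSplitCoequalizer f.hom.hom g.hom.hom c := h
  constructor
  · let q := Alg.toRetract h
    let Q : S.Variety E := ⟨B.obj.retract c h.rightSection,
      isModel_of_section q h.rightSection_π B.property⟩
    exact ⟨⟨Q, ObjectProperty.homMk q⟩, ⟨ObjectProperty.hom_ext _ (Alg.Hom.ext w), rfl⟩,
      fun ⟨_, q'⟩ ⟨_, hq'⟩ =>
        Variety.sigma_eq_of_liesOver (Q := Q) (ObjectProperty.homMk q) h.rightSection_π q' hq'⟩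
  · intro Q q hq hqc
    obtain ⟨Q, hQ⟩ := Q
    obtain ⟨rfl, hqc⟩ := Sigma.mk.inj hqc
    obtain rfl := eq_of_heq hqc
    exact ⟨Variety.isColimitOfSection hq h.rightSection_π
      ((isColimitMapCoconeCoforkEquiv _ hq).symm hc)⟩

end SplitCoequalizers

end Signature

theorem theoremT (C : Contexts.{u}) (S : Signature C) (E : Set S.Inequation) :
    -- the left adjoint: free `Σ`-algebras followed by the reflection into the variety
    (∃ (F : PartOrd.{u} ⥤ S.Alg) (R : S.Alg ⥤ S.Variety E),
      Nonempty (F ⊣ S.forget) ∧ Nonempty (R ⊣ S.varietyInclusion E) ∧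
        Nonempty (F ⋙ R ⊣ S.varietyForget E)) ∧
    -- coequalizers of `U`-split pairs are created
    CreatesSplitCoequalizers (S.varietyForget E) ∧
    -- monadicity, up to equivalence and up to isomorphism of categories
    Nonempty (MonadicRightAdjoint (S.varietyForget E)) ∧
    ∀ (F : PartOrd.{u} ⥤ S.Variety E) (adj : F ⊣ S.varietyForget E),
      IsCategoryIso (Monad.comparison adj) := by
  have hU := S.varietyForget_createsSplitCoequalizers E
  have adjV : S.free ⋙ S.reflector E ⊣ S.varietyForget E :=
    S.freeAdjunction.comp (S.reflectorAdjunction E)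
  exact ⟨⟨S.free, S.reflector E, ⟨S.freeAdjunction⟩, ⟨S.reflectorAdjunction E⟩, ⟨adjV⟩⟩, hU,
    ⟨hU.monadicRightAdjoint adjV⟩, fun _ adj => hU.isCategoryIso_comparison adj⟩
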